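/- Let $\vec{\mathbb{Z}}^2$ be the directed square lattice, with vertex set $\mathbb{Z}^2$ and a directed edge $(x,y)$ whenever $x,y$ are nearest neighbours in $\mathbb{Z}^2$ and $x_i\le y_i$ for $i=1,2$; let $\vec E$ be its edge set. A bond percolation model is a probability measure $\mathrm P$ on $\{0,1\}^{\vec E}$ with the product $\sigma$-algebra. It is positively associated if $\mathrm P[A\cap B]\ge \mathrm P[A]\,\mathrm P[B]$ for all increasing events $A,B$. It is $1$-independent if the edge statuses in $F_1$ are independent of the edge statuses in $F_2$ whenever $F_1,F_2\subseteq \vec E$ are disjoint and at distance at least $1$ in the underlying undirected graph. A model percolates if, with positive probability, there is a vertex from which infinitely many vertices can be reached by open directed paths. Let $p_a^+(\vec{\mathbb{Z}}^2)$ be the supremum of all $p\in[0,1]$ for which there is a positively associated, $1$-independent bond percolation model $\mathrm P$ with $\mathrm P[\omega(e)=1]\ge p$ for every $e\in\vec E$ that does not percolate. Let $p_c^{\mathrm{site}}(\vec{\mathbb{Z}}^2)$ be the supremum of all $p\in[0,1]$ for which Bernoulli site percolation with parameter $p$ (each vertex open independently with probability $p$) does not percolate, that is, for which almost surely no vertex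 reaches infinitely many vertices by directed paths all of whose vertices are open. Then $$p_c^{\mathrm{site}}(\vec{\mathbb{Z}}^2)\;\le\; p_a^+(\vec{\mathbb{Z}}^2)\;\le\;\sqrt{p_c^{\mathrm{site}}(\vec{\mathbb{Z}}^2)}.$$ -/

import Mathlib

open MeasureTheory

namespace OrientedPercolation

/-! Percolation on directed graphs. -/

section Graphs

/-- The type of directed edges of a digraph. -/
abbrev Edge {V : Type*} (G : Digraph V) : Type _ := {e : V × V // G.Adj e.1 e.2}

/-- `w` is an endpoint of the directed edge `e`. -/
def IsEndpoint {V : Type*} {G : Digraph V} (w : V) (e : Edge G) : Prop :=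
  w = e.1.1 ∨ w = e.1.2

/-- The edge sets `F₁` and `F₂` are at distance at least `k`, with respect to the graph distance of
the underlying undirected graph. -/
def DistGE {V : Type*} (G : Digraph V) (k : ℕ) (F₁ F₂ : Set (Edge G)) : Prop :=
  ∀ e ∈ F₁, ∀ f ∈ F₂, ∀ u v : V, IsEndpoint u e → IsEndpoint v f →
    (k : ℕ∞) ≤ G.toSimpleGraphInclusive.edist u v

/-- The directed lattice: an edge goes from `x` to `y` when `x` and `y` are nearest neighbours
in `ℤⁿ` and every coordinate of `x` is at most the corresponding coordinate of `y`. -/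
def directedLattice (n : ℕ) : Digraph (Fin n → ℤ) where
  Adj x y := (∑ i, |x i - y i|) = 1 ∧ ∀ i, x i ≤ y i

end Graphs

section BondPercolation

/-- Bond configurations; `true` means open and `false` means closed, with `false ≤ true`. -/
abbrev BondConfig {V : Type*} (G : Digraph V) : Type _ := Edge G → Bool

/-- `x → y` is an open directed edge. -/
def OpenEdge {V : Type*} {G : Digraph V} (ω : BondConfig G) (x y : V) : Prop :=
  ∃ h : G.Adj x y, ω ⟨(x, y), h⟩ = true

/-- The directed cluster of `v`: the vertices reachable from `v` by an open directed path. -/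
def bondCluster {V : Type*} {G : Digraph V} (ω : BondConfig G) (v : V) : Set V :=
  {u | Relation.ReflTransGen (OpenEdge ω) v u}

/-- With positive probability there is an infinite directed cluster. -/
def BondPercolates {V : Type*} {G : Digraph V} (P : Measure (BondConfig G)) : Prop :=
  0 < P {ω | ∃ v, (bondCluster ω v).Infinite}

/-- Any two increasing events are positively correlated. -/
def PositivelyAssociated {V : Type*} {G : Digraph V} (P : Measure (BondConfig G)) : Prop :=
  ∀ A B : Set (BondConfig G), MeasurableSet A → MeasurableSet B → IsUpperSet A → IsUpperSet B →
    P A * P B ≤ P (A ∩ B)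

/-- The statuses of the edges in `F₁` are independent of the statuses of the edges in `F₂` whenever
`F₁` and `F₂` are disjoint and at distance at least `k`. -/
def KIndependent {V : Type*} {G : Digraph V} (k : ℕ) (P : Measure (BondConfig G)) : Prop :=
  ∀ F₁ F₂ : Set (Edge G), Disjoint F₁ F₂ → DistGE G k F₁ F₂ →
    ProbabilityTheory.IndepFun (fun (ω : BondConfig G) (e : F₁) => ω e)
      (fun (ω : BondConfig G) (e : F₂) => ω e) P

/-- The class of positively associated, 1-independent bond percolation models on `G` all of whose
marginals are at least `p`. -/
structure IsPAModel {V : Type*} (G : Digraph V) (p : ℝ) (P : Measure (BondConfig G)) : Prop where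
  isProbabilityMeasure : IsProbabilityMeasure P
  positivelyAssociated : PositivelyAssociated P
  oneIndependent : KIndependent 1 P
  marginals : ∀ e : Edge G, p ≤ P.real {ω | ω e = true}

/-- The parameter `p_a⁺(G)`. -/
noncomputable def paPlus {V : Type*} (G : Digraph V) : ℝ :=
  sSup {p : ℝ | p ∈ Set.Icc (0 : ℝ) 1 ∧
    ∃ P : Measure (BondConfig G), IsPAModel G p P ∧ ¬ BondPercolates P}

end BondPercolation

section SitePercolation

/-- Site configurations; `true` means open and `false` means closed. -/
abbrev SiteConfig (V : Type*) : Type _ := V → Bool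

/-- The directed site cluster of `v`: the vertices reachable from `v` by a directed path
all of whose vertices, including both ends, are open. -/
def siteCluster {V : Type*} (G : Digraph V) (σ : SiteConfig V) (v : V) : Set V :=
  {u | σ v = true ∧ Relation.ReflTransGen (fun x y => G.Adj x y ∧ σ y = true) v u}

/-- With positive probability there is an infinite directed site cluster. -/
def SitePercolates {V : Type*} (G : Digraph V) (P : Measure (SiteConfig V)) : Prop :=
  0 < P {σ | ∃ v, (siteCluster G σ v).Infinite}

/-- Bernoulli site percolation: the sites are open independently with probability `p`. -/
noncomputable def bernoulliSite (V : Type*) (p : unitInterval) : Measure (SiteConfig V) :=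
  Measure.infinitePi fun _ : V => ProbabilityTheory.bernoulliMeasure true false p

/-- The critical probability `p_c^site(G)` of Bernoulli site percolation. -/
noncomputable def pcSite {V : Type*} (G : Digraph V) : ℝ :=
  sSup {p : ℝ | ∃ h : p ∈ Set.Icc (0 : ℝ) 1, ¬ SitePercolates G (bernoulliSite V ⟨p, h⟩)}

end SitePercolation

end OrientedPercolation

/-! Lower bound: declare an edge open when its head is open in Bernoulli site percolation. The
marginals are then `p`, Harris' inequality gives positive association, and edge sets at distance at
least 1 have no head in common, which gives 1-independence. An infinite bond cluster forces an
infinite site cluster at some out-neighbour of its root, since out-degrees are finite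
(`pcSite_le_paPlus`).

Upper bound: represent each vertex of the lattice by a horizontal edge (a dimer), so that one more
edge leads from a dimer to the dimer of each out-neighbour. Entering and crossing a new dimer
requires two open edges, which has probability at least `p ^ 2` by positive association. Explore the
dimers reachable from a given one. The past is `A ∩ B`, with `A` an increasing event of successes
and `B` a decreasing event of failures. The failures involve only edges vertex-disjoint from the
next two, so `B` is independent of the next crossing `S`, and positive association of `S` with `A ∪
Bᶜ` yields `P(S | A ∩ B) ≥ P(S)` (`PositivelyAssociated.real_mul_le_of_indep`). Hence the
exploration dominates that of site percolation with parameter `p ^ 2`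
(`DimerEmbedding.hitProb_mul_le`). If `p ^ 2` exceeds the site threshold, arbitrarily large heights
are reached with probability bounded below, so the model percolates. -/

namespace OrientedPercolation

/-! ### Product Bernoulli measures: relabelling and resampling of sites -/

section BernoulliProduct

variable {V W : Type*}

instance isProbabilityMeasure_bernoulliSite (p : unitInterval) :
    IsProbabilityMeasure (bernoulliSite V p) := by
  unfold bernoulliSite; infer_instance

theorem bernoulliSite_map_comp (p : unitInterval) {j : V → W} (hj : Function.Injective j) :
    (bernoulliSite W p).map (fun σ => σ ∘ j) = bernoulliSite V p := by
  classical
  refine Measure.eq_infinitePi _ fun s t ht => ?_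
  have hm : Measurable fun σ : SiteConfig W => σ ∘ j :=
    measurable_pi_iff.2 fun v => measurable_pi_apply (j v)
  rw [Measure.map_apply hm (MeasurableSet.pi s.countable_toSet fun i _ => ht i)]
  -- Quantifying over all preimages of `w` avoids choosing an inverse of `j`; by injectivity there
  -- is at most one.
  have hset : (fun σ : SiteConfig W => σ ∘ j) ⁻¹' (Set.pi s t) =
      Set.pi (s.map ⟨j, hj⟩ : Finset W) (fun w => {b | ∀ v, j v = w → b ∈ t v}) := by
    ext σ
    simp only [Set.mem_preimage, Set.mem_pi, Finset.mem_coe, Finset.mem_map,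
      Function.Embedding.coeFn_mk, Function.comp_apply, Set.mem_ofPred_eq]
    constructor
    · rintro h _ ⟨v, hv, rfl⟩ v' hv'
      rw [hj hv']
      exact h v hv
    · exact fun h v hv => h _ ⟨v, hv, rfl⟩ v rfl
  rw [hset, bernoulliSite, Measure.infinitePi_pi _ fun _ _ => MeasurableSet.of_discrete,
    Finset.prod_map]
  refine Finset.prod_congr rfl fun v _ => congrArg _ ?_
  ext b
  simp [hj.eq_iff]

theorem measurable_update_left [DecidableEq V] (z : V) (b : Bool) :
    Measurable fun σ : SiteConfig V => Function.update σ z b := by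
  refine measurable_pi_iff.2 fun v => ?_
  by_cases h : v = z
  · subst h; simp
  · simpa [h] using measurable_pi_apply v

/-- Resampling the state of one site. -/
theorem bernoulliSite_resample [DecidableEq V] (p : unitInterval) (z : V)
    {E : Set (SiteConfig V)} (hE : MeasurableSet E) :
    (bernoulliSite V p).real E =
      p * (bernoulliSite V p).real {σ | Function.update σ z true ∈ E} +
        (1 - p) * (bernoulliSite V p).real {σ | Function.update σ z false ∈ E} := by
  classical
  have key : unitInterval.toNNReal p •
        (bernoulliSite V p).map (fun σ => Function.update σ z true) +
      unitInterval.toNNReal (unitInterval.symm p) •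
        (bernoulliSite V p).map (fun σ => Function.update σ z false) = bernoulliSite V p := by
    refine Measure.eq_infinitePi _ fun s t ht => ?_
    have hms : MeasurableSet (Set.pi (s : Set V) t) :=
      MeasurableSet.pi s.countable_toSet fun i _ => ht i
    simp only [Measure.add_apply, Measure.smul_apply,
      Measure.map_apply (measurable_update_left z _) hms]
    by_cases hz : z ∈ s
    · have hpre : ∀ b, (fun σ : SiteConfig V => Function.update σ z b) ⁻¹' Set.pi (s : Set V) t =
          if b ∈ t z then Set.pi (s.erase z : Finset V) t else ∅ := by
        intro b
        ext σ
        by_cases hb : b ∈ t z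
        · simp only [Set.mem_preimage, Set.mem_pi, Finset.mem_coe, if_pos hb, Finset.mem_erase]
          refine ⟨fun h v hv => by simpa [hv.1] using h v hv.2, fun h v hv => ?_⟩
          by_cases hvz : v = z
          · subst hvz; simpa using hb
          · simpa [hvz] using h v ⟨hvz, hv⟩
        · simp only [Set.mem_preimage, Set.mem_pi, Finset.mem_coe, if_neg hb,
            Set.mem_empty_iff_false, iff_false]
          exact fun h => hb (by simpa using h z hz)
      have herase : bernoulliSite V p (Set.pi (s.erase z : Finset V) t) =
          ∏ i ∈ s.erase z, ProbabilityTheory.bernoulliMeasure true false p (t i) :=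
        Measure.infinitePi_pi _ fun i _ => ht i
      rw [← Finset.mul_prod_erase _ _ hz, ← herase, hpre, hpre,
        ProbabilityTheory.bernoulliMeasure_def]
      by_cases h1 : true ∈ t z <;> by_cases h2 : false ∈ t z <;>
        simp only [h1, h2, if_true, if_false, Measure.add_apply, Measure.smul_apply,
          Measure.dirac_apply' _ (ht z), Set.indicator_of_mem, Set.indicator_of_notMem,
          not_false_eq_true, Pi.one_apply, measure_empty, smul_zero, add_zero, zero_add, zero_mul,
          ENNReal.smul_def, smul_eq_mul, mul_one, mul_zero, add_mul]
    · have hpre : ∀ b, (fun σ : SiteConfig V => Function.update σ z b) ⁻¹' Set.pi (s : Set V) t =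
          Set.pi (s : Set V) t := by
        intro b
        ext σ
        simp only [Set.mem_preimage, Set.mem_pi, Finset.mem_coe]
        refine forall₂_congr fun v hv => ?_
        have hvz : v ≠ z := fun h => hz (h ▸ hv)
        rw [Function.update_of_ne hvz]
      rw [hpre, hpre, ← add_smul]
      have : unitInterval.toNNReal p + unitInterval.toNNReal (unitInterval.symm p) = 1 :=
        NNReal.coe_injective (by simp)
      rw [this, one_smul]
      exact Measure.infinitePi_pi _ fun i _ => ht i
  conv_lhs => rw [← key]
  rw [measureReal_add_apply, measureReal_nnreal_smul_apply, measureReal_nnreal_smul_apply,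
    map_measureReal_apply (measurable_update_left z _) hE,
    map_measureReal_apply (measurable_update_left z _) hE]
  rfl

end BernoulliProduct

/-! ### Harris' inequality, by merging two independent copies site by site -/

section Harris

variable {V : Type*}

/-- The embedding of sites into two copies of the site set: the sites of `S` are sent to the first
copy and the other sites to the second one. -/
def mixEmbedding [DecidableEq V] (S : Finset V) (v : V) : V ⊕ V :=
  if v ∈ S then Sum.inl v else Sum.inr v

theorem mixEmbedding_injective [DecidableEq V] (S : Finset V) :
    Function.Injective (mixEmbedding S) := by
  intro v w h
  unfold mixEmbedding at h
  split_ifs at h <;> simpa using h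

theorem measurable_comp_right {W : Type*} (j : V → W) :
    Measurable fun σ : SiteConfig W => σ ∘ j :=
  measurable_pi_iff.2 fun v => measurable_pi_apply (j v)

theorem bernoulliSite_real_comp {W : Type*} (p : unitInterval) {j : V → W}
    (hj : Function.Injective j) {E : Set (SiteConfig V)} (hE : MeasurableSet E) :
    (bernoulliSite W p).real {σ | σ ∘ j ∈ E} = (bernoulliSite V p).real E := by
  rw [← bernoulliSite_map_comp p hj, map_measureReal_apply (measurable_comp_right j) hE]
  rfl

theorem comap_comp_le_iSup {W I : Type*} (j : I → W) :
    MeasurableSpace.comap (fun σ : SiteConfig W => σ ∘ j) inferInstance ≤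
      ⨆ w ∈ Set.range j, MeasurableSpace.comap (fun σ : SiteConfig W => σ w) inferInstance := by
  rw [← measurable_iff_comap_le]
  refine @measurable_pi_iff _ _ _ (_) _ _ |>.2 fun i => ?_
  rw [measurable_iff_comap_le]
  exact le_iSup₂_of_le (j i) ⟨i, rfl⟩ le_rfl

theorem bernoulliSite_indepFun_comp {W I₁ I₂ : Type*} (p : unitInterval) {j₁ : I₁ → W}
    {j₂ : I₂ → W} (h : Disjoint (Set.range j₁) (Set.range j₂)) :
    ProbabilityTheory.IndepFun (fun σ : SiteConfig W => σ ∘ j₁) (fun σ => σ ∘ j₂)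
      (bernoulliSite W p) := by
  have hind : ProbabilityTheory.iIndep
      (fun w : W => MeasurableSpace.comap (fun σ : SiteConfig W => σ w) inferInstance)
      (bernoulliSite W p) :=
    ProbabilityTheory.iIndepFun_infinitePi (X := fun _ b => b) fun _ => measurable_id
  have hsup := ProbabilityTheory.indep_iSup_of_disjoint
    (fun w => (measurable_pi_apply w).comap_le) hind h
  exact ProbabilityTheory.indep_of_indep_of_le_left
    (ProbabilityTheory.indep_of_indep_of_le_right hsup (comap_comp_le_iSup j₂))
    (comap_comp_le_iSup j₁)

theorem update_le_update_of_le [DecidableEq V] (σ : SiteConfig V) (z : V) :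
    Function.update σ z false ≤ Function.update σ z true := by
  intro v
  by_cases h : v = z
  · subst h; simp
  · simp [h]

/-- Chebyshev's inequality for two increasing pairs of events. -/
theorem two_point_chebyshev {Ω : Type*} [MeasurableSpace Ω] (μ : Measure Ω) [IsFiniteMeasure μ]
    {a b : Bool → Set Ω} (ha : a false ⊆ a true) (hb : b false ⊆ b true)
    (hma : ∀ x, MeasurableSet (a x)) (hmb : ∀ x, MeasurableSet (b x))
    {p : ℝ} (hp0 : 0 ≤ p) (hp1 : p ≤ 1) :
    p * (p * μ.real (a true ∩ b true) + (1 - p) * μ.real (a true ∩ b false)) +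
        (1 - p) * (p * μ.real (a false ∩ b true) + (1 - p) * μ.real (a false ∩ b false)) ≤
      p * μ.real (a true ∩ b true) + (1 - p) * μ.real (a false ∩ b false) := by
  have h1 : μ.real ((a true ∩ b false) ∪ (a false ∩ b true)) +
      μ.real ((a true ∩ b false) ∩ (a false ∩ b true)) =
      μ.real (a true ∩ b false) + μ.real (a false ∩ b true) :=
    measureReal_union_add_inter ((hma _).inter (hmb _))
  have h2 : μ.real ((a true ∩ b false) ∪ (a false ∩ b true)) ≤ μ.real (a true ∩ b true) :=
    measureReal_mono (Set.union_subset (Set.inter_subset_inter_right _ hb)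
      (Set.inter_subset_inter_left _ ha))
  have h3 : μ.real ((a true ∩ b false) ∩ (a false ∩ b true)) ≤ μ.real (a false ∩ b false) :=
    measureReal_mono fun x hx => ⟨hx.2.1, hx.1.2⟩
  have h4 : 0 ≤ p * (1 - p) := mul_nonneg hp0 (sub_nonneg.2 hp1)
  -- The two sides differ by `p * (1 - p)` times the sum of the two diagonal measures minus the sum
  -- of the two off-diagonal ones.
  nlinarith [mul_nonneg h4 (sub_nonneg.2 (h1 ▸ add_le_add h2 h3))]

/-- The probability that a configuration belongs to `A` while its mixture along `S` with an
independent copy belongs to `B`. -/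
noncomputable def mixProb [DecidableEq V] (p : unitInterval) (A B : Set (SiteConfig V))
    (S : Finset V) : ℝ :=
  (bernoulliSite (V ⊕ V) p).real {ω | ω ∘ Sum.inl ∈ A ∧ ω ∘ mixEmbedding S ∈ B}

variable {A B : Set (SiteConfig V)}

/-- With `z` outside the mixing set, `A` and `B` read independent bits at `z`; after insertion they
read the same bit. Resampling these bits reduces the comparison to `two_point_chebyshev`. -/
theorem mixProb_insert_ge [DecidableEq V] (p : unitInterval) (hA : MeasurableSet A)
    (hB : MeasurableSet B) (hA' : IsUpperSet A) (hB' : IsUpperSet B) {S : Finset V} {z : V}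
    (hz : z ∉ S) : mixProb p A B S ≤ mixProb p A B (insert z S) := by
  have hinl : ∀ (ω : SiteConfig (V ⊕ V)) x,
      Function.update ω (Sum.inl z) x ∘ Sum.inl = Function.update (ω ∘ Sum.inl) z x :=
    fun ω x => Function.update_comp_eq_of_injective _ Sum.inl_injective _ _
  have hinr : ∀ (ω : SiteConfig (V ⊕ V)) x,
      Function.update ω (Sum.inr z) x ∘ Sum.inl = ω ∘ Sum.inl := by
    intro ω x; ext v; simp
  have hmixl : ∀ (ω : SiteConfig (V ⊕ V)) x,
      Function.update ω (Sum.inl z) x ∘ mixEmbedding S = ω ∘ mixEmbedding S := by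
    intro ω x
    ext v
    by_cases hv : v ∈ S
    · have : v ≠ z := fun h => hz (h ▸ hv)
      simp [mixEmbedding, hv, this]
    · simp [mixEmbedding, hv]
  have hmixr : ∀ (ω : SiteConfig (V ⊕ V)) x,
      Function.update ω (Sum.inr z) x ∘ mixEmbedding S =
        Function.update (ω ∘ mixEmbedding S) z x := by
    intro ω x
    have : mixEmbedding S z = Sum.inr z := by simp [mixEmbedding, hz]
    rw [← this]
    exact Function.update_comp_eq_of_injective _ (mixEmbedding_injective S) _ _
  have hmix' : ∀ (ω : SiteConfig (V ⊕ V)) x,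
      Function.update ω (Sum.inl z) x ∘ mixEmbedding (insert z S) =
        Function.update (ω ∘ mixEmbedding S) z x := by
    intro ω x
    ext v
    by_cases hvz : v = z
    · subst hvz; simp [mixEmbedding]
    · by_cases hv : v ∈ S <;> simp [mixEmbedding, hv, hvz]
  set a : Bool → Set (SiteConfig (V ⊕ V)) :=
    fun x => {ω | Function.update (ω ∘ Sum.inl) z x ∈ A} with ha
  set b : Bool → Set (SiteConfig (V ⊕ V)) :=
    fun x => {ω | Function.update (ω ∘ mixEmbedding S) z x ∈ B} with hb
  have hma : ∀ x, MeasurableSet (a x) := fun x =>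
    ((measurable_update_left z x).comp (measurable_comp_right _)) hA
  have hmb : ∀ x, MeasurableSet (b x) := fun x =>
    ((measurable_update_left z x).comp (measurable_comp_right _)) hB
  have hmA : MeasurableSet {ω : SiteConfig (V ⊕ V) | ω ∘ Sum.inl ∈ A} :=
    measurable_comp_right _ hA
  have hmB : ∀ S : Finset V, MeasurableSet {ω : SiteConfig (V ⊕ V) | ω ∘ mixEmbedding S ∈ B} :=
    fun S => measurable_comp_right _ hB
  have hmAb : ∀ x, MeasurableSet {ω : SiteConfig (V ⊕ V) |
      Function.update (ω ∘ Sum.inl) z x ∈ A ∧ ω ∘ mixEmbedding S ∈ B} :=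
    fun x => (hma x).inter (hmB S)
  have hcheb := two_point_chebyshev (bernoulliSite (V ⊕ V) p) (a := a) (b := b)
    (fun ω h => hA' (update_le_update_of_le _ _) h) (fun ω h => hB' (update_le_update_of_le _ _) h)
    hma hmb p.2.1 p.2.2
  have e1 : mixProb p A B S = _ :=
    bernoulliSite_resample p (Sum.inl z) (hmA.inter (hmB S))
  have e2 : mixProb p A B (insert z S) = _ :=
    bernoulliSite_resample p (Sum.inl z) (hmA.inter (hmB (insert z S)))
  simp only [Set.mem_ofPred_eq, hinl, hmixl, hmix'] at e1 e2
  rw [bernoulliSite_resample p (Sum.inr z) (hmAb true),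
    bernoulliSite_resample p (Sum.inr z) (hmAb false)] at e1
  simp only [Set.mem_ofPred_eq, hinr, hmixr] at e1
  rw [e1, e2]
  exact hcheb

theorem mixProb_empty [DecidableEq V] (p : unitInterval) (hA : MeasurableSet A)
    (hB : MeasurableSet B) :
    mixProb p A B ∅ = (bernoulliSite V p).real A * (bernoulliSite V p).real B := by
  have hind := bernoulliSite_indepFun_comp (W := V ⊕ V) p (j₁ := Sum.inl) (j₂ := Sum.inr)
    Set.isCompl_range_inl_range_inr.disjoint
  have hempty : (mixEmbedding ∅ : V → V ⊕ V) = Sum.inr := by ext v; simp [mixEmbedding]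
  have h := hind.measure_inter_preimage_eq_mul _ _ hA hB
  rw [← bernoulliSite_real_comp p Sum.inl_injective hA,
    ← bernoulliSite_real_comp p Sum.inr_injective hB, mixProb, hempty,
    measureReal_def, measureReal_def, measureReal_def, ← ENNReal.toReal_mul]
  exact congrArg ENNReal.toReal h

theorem mixProb_ge [DecidableEq V] (p : unitInterval) (hA : MeasurableSet A)
    (hB : MeasurableSet B) (hA' : IsUpperSet A) (hB' : IsUpperSet B) (S : Finset V) :
    (bernoulliSite V p).real A * (bernoulliSite V p).real B ≤ mixProb p A B S := by
  induction S using Finset.induction_on with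
  | empty => rw [mixProb_empty p hA hB]
  | insert z S hz ih => exact ih.trans (mixProb_insert_ge p hA hB hA' hB' hz)

-- The mixture agrees with the first copy on `S`, so `D` cannot distinguish them. Passing from `B`
-- to `D` costs one symmetric difference for each of the two configurations.
open scoped symmDiff in
theorem mixProb_le [DecidableEq V] (p : unitInterval) (hA : MeasurableSet A)
    (hB : MeasurableSet B) {D : Set (SiteConfig V)} (hD : MeasurableSet D) (S : Finset V)
    (hDS : ∀ σ τ : SiteConfig V, (∀ v ∈ S, σ v = τ v) → (σ ∈ D ↔ τ ∈ D)) :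
    mixProb p A B S ≤
      (bernoulliSite V p).real (A ∩ B) + 2 * (bernoulliSite V p).real (D ∆ B) := by
  have hsd : MeasurableSet (D ∆ B) := hD.symmDiff hB
  have hsub : {ω : SiteConfig (V ⊕ V) | ω ∘ Sum.inl ∈ A ∧ ω ∘ mixEmbedding S ∈ B} ⊆
      {ω | ω ∘ Sum.inl ∈ A ∩ B} ∪ ({ω | ω ∘ Sum.inl ∈ D ∆ B} ∪
        {ω | ω ∘ mixEmbedding S ∈ D ∆ B}) := by
    rintro ω ⟨h1, h2⟩
    have h3 := hDS (ω ∘ Sum.inl) (ω ∘ mixEmbedding S) fun v hv => by simp [mixEmbedding, hv]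
    simp only [Set.mem_union, Set.mem_ofPred_eq, Set.mem_inter_iff, Set.mem_symmDiff]
    tauto
  have h := (measureReal_mono (μ := bernoulliSite (V ⊕ V) p) hsub).trans
    ((measureReal_union_le _ _).trans (add_le_add_right (measureReal_union_le _ _) _))
  rw [bernoulliSite_real_comp p Sum.inl_injective (hA.inter hB),
    bernoulliSite_real_comp p Sum.inl_injective hsd,
    bernoulliSite_real_comp p (mixEmbedding_injective S) hsd] at h
  unfold mixProb
  linarith

/-- **Harris' inequality** for an arbitrary product of Bernoulli measures. -/
theorem bernoulliSite_harris (p : unitInterval) (hA : MeasurableSet A)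
    (hB : MeasurableSet B) (hA' : IsUpperSet A) (hB' : IsUpperSet B) :
    (bernoulliSite V p).real A * (bernoulliSite V p).real B ≤
      (bernoulliSite V p).real (A ∩ B) := by
  classical
  refine le_of_forall_pos_le_add fun ε hε => ?_
  -- Approximating `B` by a cylinder leaves finitely many sites to merge, even if `V` is
  -- uncountable. The cylinder need not be increasing: monotonicity is only used for `A` and `B`.
  obtain ⟨D, hD, hDB⟩ := exists_measure_symmDiff_lt_of_generateFrom_isSetRing
    (μ := bernoulliSite V p) (isSetRing_measurableCylinders (α := fun _ : V => Bool))
    ⟨{Set.univ}, Set.countable_singleton _, by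
      simpa only [Set.singleton_subset_iff] using univ_mem_measurableCylinders _, by simp⟩
    (generateFrom_measurableCylinders).symm hB (ENNReal.ofReal_pos.2 (half_pos hε))
  obtain ⟨S, T, hT, rfl⟩ := (mem_measurableCylinders _).1 hD
  have hmix := (mixProb_ge p hA hB hA' hB' S).trans (mixProb_le p hA hB
    (MeasurableSet.cylinder S hT) S (fun σ τ h => by
      have : S.restrict σ = S.restrict τ := funext fun v => h v v.2
      simp only [mem_cylinder, this]))
  have := ENNReal.toReal_lt_of_lt_ofReal hDB
  rw [← measureReal_def] at this
  linarith

end Harris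

/-! ### Measurability of clusters -/

section Measurability

variable {Ω V : Type*} [MeasurableSpace Ω]

theorem measurableSet_reflTransGen [Countable V] {r : Ω → V → V → Prop}
    (hr : ∀ x y, MeasurableSet {ω | r ω x y}) (v u : V) :
    MeasurableSet {ω | Relation.ReflTransGen (r ω) v u} := by
  -- `R n u` is the event that `u` is reached from `v` by a path of exactly `n` steps.
  let R : ℕ → V → Set Ω := fun n => Nat.rec (fun u => {_ω | u = v})
    (fun _ R u => ⋃ w, R w ∩ {ω | r ω w u}) n
  have hR : ∀ n u, MeasurableSet (R n u) := by
    intro n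
    induction n with
    | zero => exact fun u => MeasurableSet.const _
    | succ n ih => exact fun u => MeasurableSet.iUnion fun w => (ih w).inter (hr w u)
  have heq : {ω | Relation.ReflTransGen (r ω) v u} = ⋃ n, R n u := by
    ext ω
    simp only [Set.mem_iUnion, Set.mem_ofPred_eq]
    constructor
    · intro h
      induction h with
      | refl => exact ⟨0, rfl⟩
      | tail _ hbc ih =>
        obtain ⟨n, hn⟩ := ih
        exact ⟨n + 1, Set.mem_iUnion.2 ⟨_, hn, hbc⟩⟩
    · rintro ⟨n, hn⟩
      induction n generalizing u with
      | zero => exact (show u = v from hn) ▸ Relation.ReflTransGen.refl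
      | succ n ih =>
        obtain ⟨w, hw, hwu⟩ := Set.mem_iUnion.1 hn
        exact (ih w hw).tail hwu
  rw [heq]
  exact MeasurableSet.iUnion fun n => hR n u

theorem measurableSet_setOf_infinite [Countable V] {S : Ω → Set V}
    (hS : ∀ u, MeasurableSet {ω | u ∈ S ω}) : MeasurableSet {ω | (S ω).Infinite} := by
  have heq : {ω | (S ω).Infinite} = ⋂ F : Finset V, ⋃ u, ⋃ _ : u ∉ F, {ω | u ∈ S ω} := by
    ext ω
    simp only [Set.mem_iInter, Set.mem_iUnion, Set.mem_ofPred_eq, exists_prop]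
    constructor
    · intro h F
      obtain ⟨u, hu, huF⟩ := h.exists_notMem_finset F
      exact ⟨u, huF, hu⟩
    · intro h hfin
      obtain ⟨u, huF, hu⟩ := h hfin.toFinset
      exact huF (hfin.mem_toFinset.2 hu)
  rw [heq]
  exact MeasurableSet.iInter fun F => MeasurableSet.iUnion fun u => MeasurableSet.iUnion fun _ =>
    hS u

variable {G : Digraph V}

theorem measurableSet_openEdge (x y : V) : MeasurableSet {ω : BondConfig G | OpenEdge ω x y} := by
  by_cases h : G.Adj x y
  · have : {ω : BondConfig G | OpenEdge ω x y} = (fun ω => ω ⟨(x, y), h⟩) ⁻¹' {true} := by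
      ext ω; simp [OpenEdge, h]
    rw [this]
    exact measurable_pi_apply _ (measurableSet_singleton _)
  · simp [OpenEdge, h]

theorem measurableSet_mem_bondCluster [Countable V] (v u : V) :
    MeasurableSet {ω : BondConfig G | u ∈ bondCluster ω v} :=
  measurableSet_reflTransGen measurableSet_openEdge v u

end Measurability

/-! ### Lower bound: the bond model read off from the heads of edges -/

section HeadModel

variable {V : Type*} {G : Digraph V}

/-- The bond configuration in which an edge is open when its head is open. -/
def headConfig (G : Digraph V) (σ : SiteConfig V) : BondConfig G := fun e => σ e.1.2

theorem measurable_headConfig : Measurable (headConfig G) :=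
  measurable_pi_iff.2 fun e => measurable_pi_apply e.1.2

theorem monotone_headConfig : Monotone (headConfig G) := fun _ _ h e => h e.1.2

/-- The root `v` may itself be closed, so the path is cut after its first step. If all site clusters
were finite, those of the finitely many out-neighbours could not cover an infinite bond cluster. -/
theorem exists_infinite_siteCluster_of_headConfig (hG : ∀ x, {y | G.Adj x y}.Finite)
    {σ : SiteConfig V} {v : V} (h : (bondCluster (headConfig G σ) v).Infinite) :
    ∃ y, (siteCluster G σ y).Infinite := by
  by_contra! hfin
  refine h (((Set.finite_singleton v).union ((hG v).biUnion fun y _ => hfin y)).subset ?_)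
  intro u hu
  rcases Relation.ReflTransGen.cases_head hu with rfl | ⟨y, ⟨hvy, hy⟩, hyu⟩
  · exact Or.inl rfl
  · exact Or.inr (Set.mem_biUnion hvy ⟨hy, Relation.ReflTransGen.mono (fun a b ⟨hab, hb⟩ => ⟨hab, hb⟩) _ _ hyu⟩)

theorem isPAModel_map_headConfig (G : Digraph V) (p : unitInterval) :
    IsPAModel G p ((bernoulliSite V p).map (headConfig G)) where
  isProbabilityMeasure := Measure.isProbabilityMeasure_map measurable_headConfig.aemeasurable
  positivelyAssociated := by
    intro A B hA hB hA' hB'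
    rw [Measure.map_apply measurable_headConfig hA, Measure.map_apply measurable_headConfig hB,
      Measure.map_apply measurable_headConfig (hA.inter hB), Set.preimage_inter]
    have h := bernoulliSite_harris p (measurable_headConfig hA) (measurable_headConfig hB)
      (hA'.preimage monotone_headConfig) (hB'.preimage monotone_headConfig)
    rwa [measureReal_def, measureReal_def, measureReal_def, ← ENNReal.toReal_mul,
      ENNReal.toReal_le_toReal (by finiteness) (by finiteness)] at h
  oneIndependent := by
    intro F₁ F₂ _ hdist
    -- A common head would put the two edge sets at distance 0.
    have hdisj : Disjoint (Set.range fun e : F₁ => e.1.1.2) (Set.range fun e : F₂ => e.1.1.2) := by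
      rw [Set.disjoint_left]
      rintro _ ⟨e, rfl⟩ ⟨f, hf⟩
      have := hdist e e.2 f f.2 _ _ (Or.inr rfl) (Or.inr rfl)
      have hf' : f.1.1.2 = e.1.1.2 := hf
      rw [hf', SimpleGraph.edist_self] at this
      simp at this
    have hm : ∀ F : Set (Edge G), Measurable fun (ω : BondConfig G) (e : F) => ω e :=
      fun F => measurable_pi_iff.2 fun e => measurable_pi_apply _
    rw [ProbabilityTheory.indepFun_iff_measure_inter_preimage_eq_mul]
    intro s t hs ht
    rw [Measure.map_apply measurable_headConfig (hm _ hs),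
      Measure.map_apply measurable_headConfig (hm _ ht),
      Measure.map_apply measurable_headConfig ((hm _ hs).inter (hm _ ht))]
    exact (bernoulliSite_indepFun_comp p hdisj).measure_inter_preimage_eq_mul s t hs ht
  marginals := by
    intro e
    have hset : MeasurableSet {ω : BondConfig G | ω e = true} :=
      measurableSet_eq_fun (measurable_pi_apply e) measurable_const
    rw [map_measureReal_apply measurable_headConfig hset]
    have h := measurePreserving_eval_infinitePi
      (fun _ : V => ProbabilityTheory.bernoulliMeasure true false p) e.1.2
    have h' := h.measureReal_preimage (s := {true}) (measurableSet_singleton _).nullMeasurableSet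
    rw [ProbabilityTheory.bernoulliMeasure_real_apply_of_mem_of_notMem p
      (measurableSet_singleton _) (by simp) (by simp)] at h'
    exact h'.ge

theorem bddAbove_pcSite_set (G : Digraph V) : BddAbove {p : ℝ | ∃ h : p ∈ Set.Icc (0 : ℝ) 1,
    ¬ SitePercolates G (bernoulliSite V ⟨p, h⟩)} :=
  ⟨1, fun _ ⟨h, _⟩ => h.2⟩

theorem pcSite_le_paPlus [Countable V] (G : Digraph V) (hG : ∀ x, {y | G.Adj x y}.Finite) :
    pcSite G ≤ paPlus G := by
  refine Real.sSup_le (fun p ⟨hp, hperc⟩ => ?_) (Real.sSup_nonneg fun p hp => hp.1.1)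
  refine le_csSup ⟨1, fun _ h => h.1.2⟩ ⟨hp, _, isPAModel_map_headConfig G ⟨p, hp⟩, ?_⟩
  intro hb
  refine hperc (hb.trans_le ?_)
  have hmeas : MeasurableSet {ω : BondConfig G | ∃ v, (bondCluster ω v).Infinite} := by
    rw [Set.ofPred_exists]
    exact MeasurableSet.iUnion fun v =>
      measurableSet_setOf_infinite (measurableSet_mem_bondCluster v)
  rw [Measure.map_apply measurable_headConfig hmeas]
  exact measure_mono fun σ ⟨v, hv⟩ => exists_infinite_siteCluster_of_headConfig hG hv

end HeadModel

/-! ### Positive association and independence on events -/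

section PositiveAssociation

variable {W : Type*} {H : Digraph W} {P : Measure (BondConfig H)}

theorem PositivelyAssociated.real_le [IsProbabilityMeasure P] (hP : PositivelyAssociated P)
    {A B : Set (BondConfig H)} (hA : MeasurableSet A) (hB : MeasurableSet B) (hA' : IsUpperSet A)
    (hB' : IsUpperSet B) : P.real A * P.real B ≤ P.real (A ∩ B) := by
  simp only [measureReal_def, ← ENNReal.toReal_mul]
  exact ENNReal.toReal_mono (by finiteness) (hP A B hA hB hA' hB')

/-- A decreasing event that is independent of the increasing event `S` does not spoil the positive
correlation between `S` and another increasing event. -/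
theorem PositivelyAssociated.real_mul_le_of_indep [IsProbabilityMeasure P]
    (hP : PositivelyAssociated P) {S A B : Set (BondConfig H)} (hS : MeasurableSet S)
    (hA : MeasurableSet A) (hB : MeasurableSet B) (hS' : IsUpperSet S) (hA' : IsUpperSet A)
    (hB' : IsLowerSet B) (hSB : P.real (S ∩ B) = P.real S * P.real B) :
    P.real S * P.real (A ∩ B) ≤ P.real (A ∩ B ∩ S) := by
  -- `A ∪ Bᶜ` is increasing and is the disjoint union of `A ∩ B` and `Bᶜ`. By independence the
  -- contributions of `Bᶜ` cancel.
  have h := hP.real_le hS (hA.union hB.compl) hS' (hA'.union hB'.compl)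
  have h1 : P.real (A ∪ Bᶜ) = P.real (A ∩ B) + P.real Bᶜ := by
    have hd : Disjoint (A ∩ B) Bᶜ := Set.disjoint_left.2 fun ω h h' => h' h.2
    rw [← measureReal_union hd hB.compl]
    congr 1
    ext ω
    by_cases hω : ω ∈ B <;> simp [hω]
  have h2 : P.real (S ∩ (A ∪ Bᶜ)) = P.real (A ∩ B ∩ S) + P.real (S ∩ Bᶜ) := by
    have hd : Disjoint (A ∩ B ∩ S) (S ∩ Bᶜ) := Set.disjoint_left.2 fun ω h h' => h'.2 h.1.2
    rw [← measureReal_union hd (hS.inter hB.compl)]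
    congr 1
    ext ω
    by_cases hω : ω ∈ B <;> simp [hω, and_comm]
  have h3 : P.real (S ∩ B) + P.real (S ∩ Bᶜ) = P.real S := by
    rw [← Set.sdiff_eq]
    exact measureReal_inter_add_sdiff hB
  have h4 : P.real Bᶜ = 1 - P.real B := probReal_compl_eq_one_sub hB
  rw [h1, h2, h4] at h
  nlinarith

/-- The σ-algebra generated by the statuses of the edges in `F`. -/
abbrev edgeSigma (F : Set (Edge H)) : MeasurableSpace (BondConfig H) :=
  MeasurableSpace.comap (fun ω (e : F) => ω e) inferInstance

theorem edgeSigma_le (F : Set (Edge H)) : edgeSigma F ≤ MeasurableSpace.pi :=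
  Measurable.comap_le (measurable_pi_iff.2 fun _ => measurable_pi_apply _)

theorem measurableSet_edgeSigma_open {F : Set (Edge H)} {e : Edge H} (he : e ∈ F) :
    MeasurableSet[edgeSigma F] {ω | ω e = true} :=
  ⟨{η | η ⟨e, he⟩ = true}, measurableSet_eq_fun (measurable_pi_apply _) measurable_const, rfl⟩

theorem edgeSigma_mono {F F' : Set (Edge H)} (h : F ⊆ F') : edgeSigma F ≤ edgeSigma F' := by
  rintro _ ⟨s, hs, rfl⟩
  refine ⟨(fun η (e : F) => η ⟨e, h e.2⟩) ⁻¹' s, ?_, rfl⟩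
  exact measurable_pi_iff.2 (fun e => measurable_pi_apply _) hs

/-- Distance at least 1 between edge sets means precisely that no vertex is an endpoint of edges
from both. -/
theorem KIndependent.real_inter_eq_mul (hP : KIndependent 1 P) {F₁ F₂ : Set (Edge H)}
    (hF : ∀ e ∈ F₁, ∀ f ∈ F₂, ∀ x, IsEndpoint x e → ¬ IsEndpoint x f)
    {S B : Set (BondConfig H)} (hS : MeasurableSet[edgeSigma F₁] S)
    (hB : MeasurableSet[edgeSigma F₂] B) : P.real (S ∩ B) = P.real S * P.real B := by
  have hdist : DistGE H 1 F₁ F₂ := by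
    intro e he f hf u v hu hv
    rw [Nat.cast_one, Order.one_le_iff_ne_zero, Ne, SimpleGraph.edist_eq_zero_iff]
    rintro rfl
    exact hF e he f hf u hu hv
  have hdisj : Disjoint F₁ F₂ := Set.disjoint_left.2 fun e he hf =>
    hF e he e hf _ (Or.inl rfl) (Or.inl rfl)
  have h := (ProbabilityTheory.Indep_iff _ _ _).1
    ((ProbabilityTheory.IndepFun_iff_Indep _ _ _).1 (hP F₁ F₂ hdisj hdist)) S B hS hB
  simp only [measureReal_def, h, ENNReal.toReal_mul]

end PositiveAssociation

/-! ### Dimer embeddings and the edges touched by failures -/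

/-- Every vertex `z` of `G` is represented by an edge of `H`, such that these edges are pairwise
vertex-disjoint and, for every edge from `w` to `z` in `G`, there is an edge of `H` from
an endpoint of the edge representing `w` to the tail of the edge representing `z`; distinct
out-neighbours of `w` use distinct endpoints. -/
structure DimerEmbedding {V W : Type*} (G : Digraph V) (H : Digraph W) where
  tail : V → W
  head : V → W
  source : V → V → W
  adj_dimer : ∀ z, H.Adj (tail z) (head z)
  adj_source : ∀ {w z}, G.Adj w z → H.Adj (source w z) (tail z)
  source_eq : ∀ {w z}, G.Adj w z → source w z = tail w ∨ source w z = head w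
  source_inj : ∀ {w z z'}, G.Adj w z → G.Adj w z' → source w z = source w z' → z = z'
  tail_injective : Function.Injective tail
  head_injective : Function.Injective head
  tail_ne_head : ∀ z w, tail z ≠ head w

namespace DimerEmbedding

variable {V W : Type*} {G : Digraph V} {H : Digraph W} (φ : DimerEmbedding G H)

/-- The edge representing the vertex `z`. -/
def dimer (z : V) : Edge H := ⟨(φ.tail z, φ.head z), φ.adj_dimer z⟩

/-- The edge that leads from the edge representing `w` to the edge representing `z`. -/
def link {w z : V} (h : G.Adj w z) : Edge H := ⟨(φ.source w z, φ.tail z), φ.adj_source h⟩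

/-- The event that the edge representing `z` can be entered from `w` and crossed. -/
def crossing {w z : V} (h : G.Adj w z) : Set (BondConfig H) :=
  {ω | ω (φ.link h) = true} ∩ {ω | ω (φ.dimer z) = true}

/-- The edges whose status may be affected by failures to enter the sites of `C` from `O`. -/
def spoiled (O C : Finset V) : Set (Edge H) :=
  {e | ∀ x, IsEndpoint x e → (∃ c ∈ C, x = φ.tail c ∨ x = φ.head c) ∨
    ∃ w ∈ O, ∃ c ∈ C, G.Adj w c ∧ x = φ.source w c}

theorem spoiled_mono {O O' C C' : Finset V} (hO : O ⊆ O') (hC : C ⊆ C') :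
    φ.spoiled O C ⊆ φ.spoiled O' C' := by
  intro e he x hx
  rcases he x hx with ⟨c, hc, h⟩ | ⟨w, hw, c, hc, h⟩
  · exact Or.inl ⟨c, hC hc, h⟩
  · exact Or.inr ⟨w, hO hw, c, hC hc, h⟩

theorem link_mem_spoiled {O C : Finset V} {w z : V} (h : G.Adj w z) (hw : w ∈ O) (hz : z ∈ C) :
    φ.link h ∈ φ.spoiled O C := by
  rintro x (rfl | rfl)
  · exact Or.inr ⟨w, hw, z, hz, h, rfl⟩
  · exact Or.inl ⟨z, hz, Or.inl rfl⟩

theorem dimer_mem_spoiled {O C : Finset V} {z : V} (hz : z ∈ C) :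
    φ.dimer z ∈ φ.spoiled O C := by
  rintro x (rfl | rfl)
  · exact Or.inl ⟨z, hz, Or.inl rfl⟩
  · exact Or.inl ⟨z, hz, Or.inr rfl⟩

theorem measurableSet_crossing {w z : V} (h : G.Adj w z) {F : Set (Edge H)}
    (h₁ : φ.link h ∈ F) (h₂ : φ.dimer z ∈ F) : MeasurableSet[edgeSigma F] (φ.crossing h) :=
  @MeasurableSet.inter _ (edgeSigma F) _ _ (measurableSet_edgeSigma_open h₁)
    (measurableSet_edgeSigma_open h₂)

theorem isUpperSet_open (e : Edge H) : IsUpperSet {ω : BondConfig H | ω e = true} :=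
  fun _ _ h hω => top_le_iff.1 (hω ▸ h e : true ≤ _)

theorem isUpperSet_crossing {w z : V} (h : G.Adj w z) : IsUpperSet (φ.crossing h) :=
  (isUpperSet_open _).inter (isUpperSet_open _)

/-- This makes the next crossing independent of all past failures. The dimer of `z` is new, so
neither of its endpoints is spoiled. The source of the link lies on the dimer of the explored vertex
`w`, which is not in `C`, and by `source_inj` the failed links out of `w` start at its other
endpoint. -/
theorem not_isEndpoint_spoiled {O C : Finset V} (hOC : Disjoint O C) {w z : V} (h : G.Adj w z)
    (hw : w ∈ O) (hzO : z ∉ O) (hzC : z ∉ C) :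
    ∀ e ∈ ({φ.link h, φ.dimer z} : Set (Edge H)), ∀ f ∈ φ.spoiled O C, ∀ x,
      IsEndpoint x e → ¬ IsEndpoint x f := by
  intro e he f hf x hxe hxf
  have hx : x = φ.source w z ∨ x = φ.tail z ∨ x = φ.head z := by
    rcases he with rfl | rfl <;> rcases hxe with h | h <;> simp [h, link, dimer]
  have htt : ∀ a b, φ.tail a = φ.tail b → a = b := fun a b h => φ.tail_injective h
  have hhh : ∀ a b, φ.head a = φ.head b → a = b := fun a b h => φ.head_injective h
  have hth := φ.tail_ne_head
  have hO : ∀ c ∈ C, c ∉ O := fun c hc hO => Finset.disjoint_left.1 hOC hO hc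
  have hs := φ.source_eq h
  rcases hf x hxf with ⟨c, hc, hxc⟩ | ⟨w', hw', c, hc, hadj, hxc⟩
  · grind
  · have hs' := φ.source_eq hadj
    by_cases hww : w = w'
    · subst hww
      have := φ.source_inj h hadj
      grind
    · grind

end DimerEmbedding

/-! ### Site percolation conditioned on explored open and closed sites -/

section SiteExploration

variable {V : Type*}

/-- The configuration `σ`, with the sites of `O` opened and the sites of `C \ O` closed. -/
def override [DecidableEq V] (O C : Finset V) (σ : SiteConfig V) : SiteConfig V :=
  fun u => if u ∈ O then true else if u ∈ C then false else σ u

theorem override_update_true [DecidableEq V] {O C : Finset V} {z : V} (hC : z ∉ C) (σ : SiteConfig V) :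
    override O C (Function.update σ z true) = override (insert z O) C σ := by
  ext u
  by_cases hu : u = z
  · subst hu; simp [override, hC]
  · simp [override, hu]

theorem override_update_false [DecidableEq V] {O C : Finset V} {z : V} (σ : SiteConfig V) :
    override O C (Function.update σ z false) = override O (insert z C) σ := by
  ext u
  by_cases hu : u = z
  · subst hu; simp [override]
  · simp [override, hu]

theorem override_insert_le [DecidableEq V] {O C : Finset V} {z : V} (σ : SiteConfig V) :
    override O (insert z C) σ ≤ override (insert z O) C σ := by
  intro u
  by_cases hu : u = z
  · subst hu; simp [override, Bool.le_true]
  · simp [override, hu]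

/-- The event that `T` is reached from `v` by a directed path whose vertices other than `v`
are open. -/
def siteHits (G : Digraph V) (v : V) (T : Set V) : Set (SiteConfig V) :=
  {σ | ∃ u ∈ T, Relation.ReflTransGen (fun x y => G.Adj x y ∧ σ y = true) v u}

theorem isUpperSet_siteHits (G : Digraph V) (v : V) (T : Set V) :
    IsUpperSet (siteHits G v T) := fun _ _ h ⟨u, hu, hvu⟩ =>
  ⟨u, hu, Relation.ReflTransGen.mono
    (fun _ y ⟨hxy, hy⟩ => ⟨hxy, top_le_iff.1 (hy ▸ h y : true ≤ _)⟩) _ _ hvu⟩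

theorem measurableSet_siteHits [Countable V] (G : Digraph V) (v : V) (T : Set V) :
    MeasurableSet (siteHits G v T) := by
  have h : siteHits G v T = ⋃ u ∈ T,
      {σ | Relation.ReflTransGen (fun x y => G.Adj x y ∧ σ y = true) v u} := by
    ext σ; simp [siteHits]
  rw [h]
  refine MeasurableSet.biUnion (Set.to_countable T) fun u _ =>
    measurableSet_reflTransGen (fun x y => ?_) v u
  exact (MeasurableSet.const _).inter
    (measurableSet_eq_fun (measurable_pi_apply y) measurable_const)

theorem measurable_override [DecidableEq V] (O C : Finset V) : Measurable (override O C) := by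
  refine measurable_pi_iff.2 fun u => ?_
  unfold override
  split_ifs
  · exact measurable_const
  · exact measurable_const
  · exact measurable_pi_apply u

/-- The probability that Bernoulli site percolation hits `T` from `v`, given that the sites of `O`
are open and the sites of `C` are closed. -/
noncomputable def hitProb [DecidableEq V] (G : Digraph V) (q : unitInterval) (v : V) (T : Set V)
    (O C : Finset V) : ℝ :=
  (bernoulliSite V q).real (override O C ⁻¹' siteHits G v T)

theorem hitProb_eq_resample [DecidableEq V] [Countable V] (G : Digraph V) (q : unitInterval) (v : V) (T : Set V)
    {O C : Finset V} {z : V} (hC : z ∉ C) :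
    hitProb G q v T O C = q * hitProb G q v T (insert z O) C +
      (1 - q) * hitProb G q v T O (insert z C) := by
  have h := bernoulliSite_resample q z (measurable_override O C (measurableSet_siteHits G v T))
  simp only [Set.mem_preimage, override_update_true hC, override_update_false] at h
  exact h

theorem hitProb_insert_le [DecidableEq V] (G : Digraph V) (q : unitInterval) (v : V) (T : Set V)
    (O C : Finset V) (z : V) :
    hitProb G q v T O (insert z C) ≤ hitProb G q v T (insert z O) C :=
  measureReal_mono fun σ hσ => isUpperSet_siteHits G v T (override_insert_le σ) hσ

/-- When the exploration has stopped, every way out of `O` leads to a closed site, so no open path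
leaves `O`. -/
theorem hitProb_eq_zero [DecidableEq V] {G : Digraph V} (q : unitInterval) {v : V} {T : Set V}
    {O C : Finset V} (hOC : Disjoint O C) (hv : v ∈ O) (hT : ∀ u ∈ O, u ∉ T)
    (hclosed : ∀ w ∈ O, ∀ z, G.Adj w z → z ∈ O ∨ z ∈ C) : hitProb G q v T O C = 0 := by
  have h : override O C ⁻¹' siteHits G v T = ∅ := by
    refine Set.eq_empty_of_forall_notMem fun σ ⟨u, huT, hvu⟩ => hT u ?_ huT
    clear huT
    induction hvu with
    | refl => exact hv
    | tail _ hbc ih =>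
      rcases hclosed _ ih _ hbc.1 with h | h
      · exact h
      · have := hbc.2
        simp [override, Finset.disjoint_right.1 hOC h, h] at this
  rw [hitProb, h, measureReal_empty]

end SiteExploration

/-! ### Comparison of the bond exploration with site percolation -/

namespace DimerEmbedding

variable {V W : Type*} {G : Digraph V} {H : Digraph W}
  (φ : DimerEmbedding G H) {P : Measure (BondConfig H)} {p : ℝ}

/-- The event that there is an open path from the edge representing `v` to the edge representing
some element of `T`. -/
def bondHits (v : V) (T : Set V) : Set (BondConfig H) :=
  {ω | ∃ u ∈ T, φ.tail u ∈ bondCluster ω (φ.tail v)}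

theorem sq_le_real_crossing (hP : IsPAModel H p P) (hp : 0 ≤ p) {w z : V} (h : G.Adj w z) :
    p ^ 2 ≤ P.real (φ.crossing h) := by
  have := hP.isProbabilityMeasure
  have hm : ∀ e : Edge H, MeasurableSet {ω : BondConfig H | ω e = true} := fun e =>
    measurableSet_eq_fun (measurable_pi_apply e) measurable_const
  refine le_trans ?_ (hP.positivelyAssociated.real_le (hm _) (hm _) (isUpperSet_open _)
    (isUpperSet_open _))
  rw [sq]
  exact mul_le_mul (hP.marginals _) (hP.marginals _) hp measureReal_nonneg

/-- Comparison of the exploration of a cluster in a positively associated, 1-independent model with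
the exploration of a site cluster. The events `A` and `B` record the successful and the failed steps
of the exploration so far. -/
theorem hitProb_mul_le [DecidableEq V] [Countable V] (hP : IsPAModel H p P) (hp : 0 ≤ p) {q : unitInterval}
    (hq : (q : ℝ) ≤ p ^ 2) {v : V} {T : Set V} {Λ : Finset V}
    (hΛ : ∀ x ∈ Λ, x ∉ T → ∀ y, G.Adj x y → y ∈ Λ) (n : ℕ) (O C : Finset V)
    (hn : (Λ \ (O ∪ C)).card = n) (hOC : Disjoint O C) (hv : v ∈ O) (hOΛ : O ⊆ Λ)
    {A B : Set (BondConfig H)} (hA : MeasurableSet A) (hA' : IsUpperSet A)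
    (hB : MeasurableSet[edgeSigma (φ.spoiled O C)] B) (hB' : IsLowerSet B)
    (hreach : ∀ ω ∈ A, ∀ w ∈ O, φ.tail w ∈ bondCluster ω (φ.tail v) ∧
      OpenEdge ω (φ.tail w) (φ.head w)) :
    hitProb G q v T O C * P.real (A ∩ B) ≤ P.real (φ.bondHits v T ∩ (A ∩ B)) := by
  have := hP.isProbabilityMeasure
  induction n using Nat.strong_induction_on generalizing O C A B with
  | _ n ih =>
  by_cases hT : ∃ u ∈ O, u ∈ T
  · obtain ⟨u, huO, huT⟩ := hT
    have hsub : φ.bondHits v T ∩ (A ∩ B) = A ∩ B :=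
      Set.inter_eq_right.2 fun ω hω => ⟨u, huT, (hreach ω hω.1 u huO).1⟩
    rw [hsub]
    exact mul_le_of_le_one_left measureReal_nonneg measureReal_le_one
  push Not at hT
  by_cases hz : ∃ w ∈ O, ∃ z, G.Adj w z ∧ z ∉ O ∧ z ∉ C
  · obtain ⟨w, hw, z, hwz, hzO, hzC⟩ := hz
    have hBm : MeasurableSet B := edgeSigma_le _ _ hB
    have hSm : MeasurableSet (φ.crossing hwz) :=
      edgeSigma_le Set.univ _ (φ.measurableSet_crossing hwz trivial trivial)
    have hSu := φ.isUpperSet_crossing hwz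
    have hzΛ : z ∈ Λ := hΛ w (hOΛ hw) (hT w hw) z hwz
    have hzmem : z ∈ Λ \ (O ∪ C) := by simp [hzΛ, hzO, hzC]
    have hcard : (Λ \ insert z (O ∪ C)).card < n := by
      rw [← hn]
      exact Finset.card_lt_card (by grind)
    have hspoil : φ.spoiled O C ⊆ φ.spoiled O (insert z C) :=
      φ.spoiled_mono subset_rfl (Finset.subset_insert _ _)
    -- Success: `z` becomes open and the crossing joins the increasing event `A`.
    have h₁ := ih _ hcard (insert z O) C (by rw [Finset.insert_union])
      (Finset.disjoint_insert_left.2 ⟨hzC, hOC⟩) (Finset.mem_insert_of_mem hv)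
      (Finset.insert_subset hzΛ hOΛ) (hA.inter hSm) (hA'.inter hSu)
      (edgeSigma_mono (φ.spoiled_mono (Finset.subset_insert _ _) subset_rfl) _ hB) hB' (by
        intro ω hω x hx
        rcases Finset.mem_insert.1 hx with rfl | hx
        · obtain ⟨h₁, h₂⟩ := hreach ω hω.1 w hw
          have hsource : φ.source w x ∈ bondCluster ω (φ.tail v) := by
            rcases φ.source_eq hwz with h | h
            · rw [h]; exact h₁
            · rw [h]; exact Relation.ReflTransGen.tail h₁ h₂
          exact ⟨Relation.ReflTransGen.tail hsource ⟨_, hω.2.1⟩, ⟨_, hω.2.2⟩⟩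
        · exact hreach ω hω.1 x hx)
    -- Failure: `z` becomes closed and the complement of the crossing joins the decreasing event
    -- `B`, whose edges remain spoiled.
    have h₀ := ih _ hcard O (insert z C) (by rw [Finset.union_insert])
      (Finset.disjoint_insert_right.2 ⟨hzO, hOC⟩) hv hOΛ hA hA'
      (@MeasurableSet.inter _ (edgeSigma _) _ _ (edgeSigma_mono hspoil _ hB)
        (@MeasurableSet.compl _ _ (edgeSigma _) (φ.measurableSet_crossing hwz
          (φ.link_mem_spoiled hwz hw (Finset.mem_insert_self z C))
          (φ.dimer_mem_spoiled (Finset.mem_insert_self z C)))))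
      (hB'.inter hSu.compl) hreach
    have hind : P.real (φ.crossing hwz ∩ B) = P.real (φ.crossing hwz) * P.real B :=
      hP.oneIndependent.real_inter_eq_mul (φ.not_isEndpoint_spoiled hOC hwz hw hzO hzC)
        (φ.measurableSet_crossing hwz (Or.inl rfl) (Or.inr rfl)) hB
    have hcorr := hP.positivelyAssociated.real_mul_le_of_indep hSm hA hBm hSu hA' hB' hind
    have hsq : q * P.real (A ∩ B) ≤ P.real (A ∩ B ∩ φ.crossing hwz) :=
      (mul_le_mul_of_nonneg_right (hq.trans (φ.sq_le_real_crossing hP hp hwz))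
        measureReal_nonneg).trans hcorr
    have hsplit := measureReal_inter_add_sdiff (μ := P) (s := A ∩ B) hSm
    have hsplit' := measureReal_inter_add_sdiff (μ := P) (s := φ.bondHits v T ∩ (A ∩ B)) hSm
    have hmono := hitProb_insert_le G q v T O C z
    rw [Set.inter_right_comm A, ← Set.inter_assoc (φ.bondHits v T)] at h₁
    rw [← Set.inter_assoc A, ← Set.inter_assoc (φ.bondHits v T), ← Set.sdiff_eq,
      ← Set.sdiff_eq] at h₀
    rw [hitProb_eq_resample G q v T hzC, ← hsplit', ← hsplit]
    rw [← hsplit] at hsq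
    -- The slack is (hit probability with `z` open minus that with `z` closed) times (success
    -- probability minus `q` times the total), and both factors are nonnegative.
    nlinarith [mul_nonneg (sub_nonneg.2 hmono) (sub_nonneg.2 hsq)]
  · push Not at hz
    rw [hitProb_eq_zero q hOC hv hT fun w hw z hwz => or_iff_not_imp_left.2 (hz w hw z hwz),
      zero_mul]
    exact measureReal_nonneg

/-- The exploration starts once the dimer of `v` is open, whence the factor `p`. -/
theorem hitProb_singleton_mul_le [DecidableEq V] [Countable V] (hP : IsPAModel H p P) (hp : 0 ≤ p) {q : unitInterval}
    (hq : (q : ℝ) ≤ p ^ 2) {v : V} {T : Set V} {Λ : Finset V} (hvΛ : v ∈ Λ)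
    (hΛ : ∀ x ∈ Λ, x ∉ T → ∀ y, G.Adj x y → y ∈ Λ) :
    hitProb G q v T {v} ∅ * p ≤ P.real (φ.bondHits v T) := by
  have := hP.isProbabilityMeasure
  have h := φ.hitProb_mul_le hP hp hq hΛ _ {v} ∅ rfl (Finset.disjoint_empty_right _)
    (Finset.mem_singleton_self v) (Finset.singleton_subset_iff.2 hvΛ)
    (A := {ω | ω (φ.dimer v) = true}) (B := Set.univ)
    (measurableSet_eq_fun (measurable_pi_apply _) measurable_const) (isUpperSet_open _)
    (@MeasurableSet.univ _ (edgeSigma _)) isLowerSet_univ (by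
      intro ω hω w hw
      rw [Finset.mem_singleton.1 hw]
      exact ⟨Relation.ReflTransGen.refl, _, hω⟩)
  rw [Set.inter_univ] at h
  exact (mul_le_mul_of_nonneg_left (hP.marginals (φ.dimer v)) measureReal_nonneg).trans
    (h.trans (measureReal_mono Set.inter_subset_left))

/-- A cluster that misses `T` stays inside the finite set `Λ`; opening `v` only helps to hit `T`. -/
theorem siteCluster_infinite_le_hitProb [DecidableEq V] (q : unitInterval) {v : V} {T : Set V}
    {Λ : Finset V} (hvΛ : v ∈ Λ) (hΛ : ∀ x ∈ Λ, x ∉ T → ∀ y, G.Adj x y → y ∈ Λ) :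
    (bernoulliSite V q).real {σ | (siteCluster G σ v).Infinite} ≤ hitProb G q v T {v} ∅ := by
  refine measureReal_mono fun σ hσ => ?_
  have hle : σ ≤ override {v} ∅ σ := by
    intro u
    by_cases hu : u = v
    · simp [override, hu, Bool.le_true]
    · simp [override, hu]
  refine isUpperSet_siteHits G v T hle ?_
  by_contra hnot
  refine hσ (Λ.finite_toSet.subset ?_)
  rintro u ⟨-, hvu⟩
  induction hvu with
  | refl => exact hvΛ
  | tail hvb hbc ih => exact hΛ _ ih (fun hT => hnot ⟨_, hT, hvb⟩) _ hbc.1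

/-- If Bernoulli site percolation with parameter at most `p ^ 2` percolates on `G`, and finite parts
of `G` separate any vertex from vertices that are far away with respect to the height `f`, then
every positively associated, 1-independent model with marginals at least `p` percolates on `H`. -/
theorem bondPercolates_of_sitePercolates [Countable V] [Countable W] (hP : IsPAModel H p P) (hp : 0 < p)
    {q : unitInterval} (hq : (q : ℝ) ≤ p ^ 2) (f : W → ℤ)
    (hex : ∀ (v : V) (N : ℕ), ∃ (Λ : Finset V) (T : Set V), v ∈ Λ ∧
      (∀ x ∈ Λ, x ∉ T → ∀ y, G.Adj x y → y ∈ Λ) ∧ ∀ u ∈ T, (N : ℤ) ≤ f (φ.tail u))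
    (hsite : SitePercolates G (bernoulliSite V q)) : BondPercolates P := by
  classical
  have := hP.isProbabilityMeasure
  have hpos : ∃ v, 0 < bernoulliSite V q {σ | (siteCluster G σ v).Infinite} := by
    by_contra! h
    refine hsite.ne' ?_
    rw [Set.ofPred_exists, measure_iUnion_null_iff]
    exact fun v => le_antisymm (h v) bot_le
  obtain ⟨v, hv⟩ := hpos
  have hc : 0 < (bernoulliSite V q).real {σ | (siteCluster G σ v).Infinite} :=
    ENNReal.toReal_pos hv.ne' (measure_ne_top _ _)
  set c := (bernoulliSite V q).real {σ | (siteCluster G σ v).Infinite}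
  let R : ℕ → Set (BondConfig H) := fun N => {ω | ∃ x, (N : ℤ) ≤ f x ∧
    x ∈ bondCluster ω (φ.tail v)}
  have hRm : ∀ N, MeasurableSet (R N) := by
    intro N
    have h : R N = ⋃ x, ⋃ _ : (N : ℤ) ≤ f x, {ω | x ∈ bondCluster ω (φ.tail v)} := by
      ext ω; simp [R]
    rw [h]
    exact MeasurableSet.iUnion fun x => MeasurableSet.iUnion fun _ =>
      measurableSet_mem_bondCluster _ x
  have hRanti : Antitone R := fun M N hMN ω ⟨x, hx, hxω⟩ =>
    ⟨x, (Int.ofNat_le.2 hMN).trans hx, hxω⟩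
  have hR : ∀ N, ENNReal.ofReal (c * p) ≤ P (R N) := by
    intro N
    obtain ⟨Λ, T, hvΛ, hΛ, hT⟩ := hex v N
    refine ENNReal.ofReal_le_of_le_toReal ?_
    refine ((mul_le_mul_of_nonneg_right (siteCluster_infinite_le_hitProb q hvΛ hΛ) hp.le).trans
      (φ.hitProb_singleton_mul_le hP hp.le hq hvΛ hΛ)).trans ?_
    exact measureReal_mono fun ω ⟨u, hu, huω⟩ => ⟨_, hT u hu, huω⟩
  -- The lower bound `c * p` does not depend on `N`, so it survives in the intersection, where `f`
  -- is unbounded on the cluster.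
  have hlim := tendsto_measure_iInter_atTop (μ := P) (fun N => (hRm N).nullMeasurableSet) hRanti
    ⟨0, measure_ne_top _ _⟩
  have hinter : 0 < P (⋂ N, R N) :=
    (ENNReal.ofReal_pos.2 (mul_pos hc hp)).trans_le (ge_of_tendsto' hlim hR)
  refine hinter.trans_le (measure_mono fun ω hω => ⟨φ.tail v, fun hfin => ?_⟩)
  obtain ⟨M, hM⟩ := (hfin.image f).bddAbove
  obtain ⟨x, hx, hxω⟩ := Set.mem_iInter.1 hω (M.toNat + 1)
  have := hM (Set.mem_image_of_mem f hxω)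
  omega

end DimerEmbedding

/-! ### Upper bound: horizontal dimers in the square lattice -/

section SquareLattice

theorem directedLattice_adj_iff {x y : Fin 2 → ℤ} : (directedLattice 2).Adj x y ↔
    (y 0 = x 0 + 1 ∧ y 1 = x 1) ∨ (y 0 = x 0 ∧ y 1 = x 1 + 1) := by
  simp only [directedLattice, Fin.sum_univ_two, Fin.forall_fin_two]
  rcases abs_cases (x 0 - y 0) with h₀ | h₀ <;> rcases abs_cases (x 1 - y 1) with h₁ | h₁ <;> omega

theorem directedLattice_finite_out (x : Fin 2 → ℤ) :
    {y | (directedLattice 2).Adj x y}.Finite := by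
  refine (Set.finite_Icc x (x + 1)).subset fun y hy => ?_
  have := directedLattice_adj_iff.1 hy
  simp only [Set.mem_Icc, Pi.le_def, Fin.forall_fin_two, Pi.add_apply, Pi.one_apply]
  omega

theorem eq_of_apply_zero_one {x y : Fin 2 → ℤ} (h₀ : x 0 = y 0) (h₁ : x 1 = y 1) : x = y :=
  funext (Fin.forall_fin_two.2 ⟨h₀, h₁⟩)

/-- The vertex `(a, b)` is represented by the edge from `(2a, b)` to `(2a + 1, b)`; one moves up
from its tail and right from its head. -/
def latticeDimerEmbedding : DimerEmbedding (directedLattice 2) (directedLattice 2) where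
  tail z := ![2 * z 0, z 1]
  head z := ![2 * z 0 + 1, z 1]
  -- The first coordinate is `2 * w 0` (the tail) for an upward step and `2 * w 0 + 1` (the head)
  -- for a step to the right.
  source w z := ![w 0 + z 0, w 1]
  adj_dimer z := by simp [directedLattice_adj_iff]
  adj_source {w z} h := by
    rw [directedLattice_adj_iff] at h ⊢
    simp only [Matrix.cons_val_zero, Matrix.cons_val_one]
    omega
  source_eq {w z} h := by
    rw [directedLattice_adj_iff] at h
    rcases h with h | h
    · exact Or.inr (eq_of_apply_zero_one (by simp; omega) rfl)
    · exact Or.inl (eq_of_apply_zero_one (by simp; omega) rfl)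
  source_inj {w z z'} h h' he := by
    rw [directedLattice_adj_iff] at h h'
    have := congrFun he 0
    simp only [Matrix.cons_val_zero] at this
    exact eq_of_apply_zero_one (by omega) (by omega)
  tail_injective z w h := by
    have h₀ := congrFun h 0
    have h₁ := congrFun h 1
    simp only [Matrix.cons_val_zero, Matrix.cons_val_one] at h₀ h₁
    exact eq_of_apply_zero_one (by omega) h₁
  head_injective z w h := by
    have h₀ := congrFun h 0
    have h₁ := congrFun h 1
    simp only [Matrix.cons_val_zero, Matrix.cons_val_one] at h₀ h₁
    exact eq_of_apply_zero_one (by omega) h₁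
  tail_ne_head z w h := by
    have h₀ := congrFun h 0
    simp only [Matrix.cons_val_zero] at h₀
    omega

/-- A triangle with corner `v`, whose hypotenuse `T` is far away from `v`, cannot be left without
visiting `T`. -/
theorem exists_triangle (v : Fin 2 → ℤ) (N : ℕ) : ∃ (Λ : Finset (Fin 2 → ℤ))
    (T : Set (Fin 2 → ℤ)), v ∈ Λ ∧
      (∀ x ∈ Λ, x ∉ T → ∀ y, (directedLattice 2).Adj x y → y ∈ Λ) ∧
      ∀ u ∈ T, (N : ℤ) ≤ latticeDimerEmbedding.tail u 0 + latticeDimerEmbedding.tail u 1 := by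
  -- On the hypotenuse `u 0 + u 1 = v 0 + v 1 + M` and `u 0 ≥ v 0`, so the tail of `u` has height `2
  -- * u 0 + u 1 ≥ M + (2 * v 0 + v 1)`.
  obtain ⟨M, hM, hM₀⟩ : ∃ M : ℤ, N ≤ M + (2 * v 0 + v 1) ∧ 0 ≤ M := by
    refine ⟨N + |2 * v 0 + v 1|, ?_, by positivity⟩
    have := neg_abs_le (2 * v 0 + v 1)
    omega
  refine ⟨(Finset.Icc v fun i => v i + M).filter fun u => u 0 + u 1 ≤ v 0 + v 1 + M,
    {u | v ≤ u ∧ u 0 + u 1 = v 0 + v 1 + M}, ?_, ?_, ?_⟩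
  · simp only [Finset.mem_filter, Finset.mem_Icc, Pi.le_def, Fin.forall_fin_two]
    omega
  · intro x hx hxT y hxy
    rw [directedLattice_adj_iff] at hxy
    simp only [Finset.mem_filter, Finset.mem_Icc, Pi.le_def, Fin.forall_fin_two,
      Set.mem_ofPred_eq] at hx hxT ⊢
    omega
  · rintro u ⟨hvu, hu⟩
    have hvu₀ : v 0 ≤ u 0 := hvu 0
    simp only [latticeDimerEmbedding, Matrix.cons_val_zero, Matrix.cons_val_one]
    omega

theorem pcSite_nonneg {V : Type*} (G : Digraph V) : 0 ≤ pcSite G :=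
  Real.sSup_nonneg fun _ ⟨h, _⟩ => h.1

theorem paPlus_directedLattice_le :
    paPlus (directedLattice 2) ≤ Real.sqrt (pcSite (directedLattice 2)) := by
  refine Real.sSup_le (fun p ⟨hp, P, hP, hperc⟩ => ?_) (Real.sqrt_nonneg _)
  refine Real.le_sqrt_of_sq_le (le_of_not_gt fun hlt => hperc ?_)
  have hp0 : 0 < p := hp.1.lt_of_ne' fun h => by
    rw [h] at hlt
    have := pcSite_nonneg (directedLattice 2)
    norm_num at hlt
    linarith
  have hq : p ^ 2 ∈ Set.Icc (0 : ℝ) 1 := ⟨sq_nonneg p, pow_le_one₀ hp.1 hp.2⟩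
  refine latticeDimerEmbedding.bondPercolates_of_sitePercolates hP hp0 (q := ⟨p ^ 2, hq⟩) le_rfl
    (fun x => x 0 + x 1) exists_triangle ?_
  by_contra hsite
  exact hlt.not_ge (le_csSup (bddAbove_pcSite_set _) ⟨hq, hsite⟩)

end SquareLattice

end OrientedPercolation

theorem theorem5 :
    OrientedPercolation.pcSite (OrientedPercolation.directedLattice 2) ≤
        OrientedPercolation.paPlus (OrientedPercolation.directedLattice 2) ∧
      OrientedPercolation.paPlus (OrientedPercolation.directedLattice 2) ≤
        Real.sqrt (OrientedPercolation.pcSite (OrientedPercolation.directedLattice 2)) :=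
  ⟨OrientedPercolation.pcSite_le_paPlus _ OrientedPercolation.directedLattice_finite_out,
    OrientedPercolation.paPlus_directedLattice_le⟩
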